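/- Let $n\ge 0$ and write $[m]=\{1,\dots,m\}$. A poset $P$ with $n$ elements is a \emph{unit interval order} if there are real numbers $q_i$ ($i\in P$), pairwise distinct, such that $i<_P j$ if and only if $q_i+1<q_j$. Let $\mathcal U_n$ be the set of isomorphism classes of unit interval orders with $n$ elements. A poset on the label set $[n]$ is \emph{canonically labeled} if $\alpha(i)<\alpha(j)$ implies $i<j$ as integers, where $\alpha(i)=|\{j: j\le_P i\}|-|\{j : i\le_P j\}|$; every finite poset has such a labeling. The \emph{antiadjacency matrix} of a poset $P$ on $[n]$ is the $n\times n$ matrix $(a_{i,j})$ with $a_{i,j}=0$ if $i<_P j$ and $a_{i,j}=1$ otherwise. The map $\varphi$ sends a class in $\mathcal U_n$ to the antiadjacency matrix of any canonically labeled representative of it; this matrix does not depend on the choice. An $n\times n$ matrix with entries in $\{0,1\}$ is a \emph{Dyck matrix} if its zero entries (above) are separated from its one entries (below) by a Dyck path, that is, a path of $n$ unit steps east and $n$ unit steps south from the upper-left to the lower-right corner that never goes below the main diagonal. Let $\mathcal D_n$ be the set of $n\times n$ Dyck matrices. Let $\mathrm{Mat}^{\ge 0}_{d,m}$ be the set of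 real $d\times m$ matrices of rank $d$ all of whose maximal minors are nonnegative. For a real $n\times n$ matrix $A=(a_{i,j})$ let $\psi(A)$ be the $n\times 2n$ matrix whose first $n$ columns form the identity matrix and whose entry in row $i$ and column $n+j$ is $(-1)^{n-i}a_{n+1-i,\,j}$ for $1\le i,j\le n$. For a real $d\times m$ matrix $B$ let $\rho(B)$ be the matroid on $[m]$ in which a set is independent if and only if the corresponding columns of $B$ are linearly independent. A \emph{positroid} on $[m]$ is a matroid $\rho(B)$ with $B\in\mathrm{Mat}^{\ge 0}_{d,m}$ for some $d$. A positroid $M$ on $[2n]$ is a \emph{unit interval positroid} if $M=\rho(\psi(A))$ for the antiadjacency matrix $A$ of some unit interval order on $[n]$ that is labeled so that $A$ is a Dyck matrix. Let $\mathcal P_n$ be the set of all unit interval positroids on $[2n]$ (as labeled matroids, not up to isomorphism). Then $\varphi$ maps $\mathcal U_n$ into $\mathcal D_n$, $\psi\circ\varphi$ maps $\mathcal U_n$ into $\mathrm{Mat}^{\ge0}_{n,2n}$, and $$\rho\circ\psi\circ\varphi\colon \mathcal U_n\to\mathcal P_n$$ is a bijection. Consequently the number of unit interval positroids on $[2n]$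 is the $n$-th Catalan number $\frac1{n+1}\binom{2n}{n}$. -/

import Mathlib

namespace UnitIntervalPositroid

/-- An `n`-labeled poset: a partial order on the label set `Fin n`, the labels `1, …, n` being
written `0, …, n - 1`.  It is wrapped in a structure to keep it apart from the order of integers on
`Fin n`, which is what `≤` and `<` on labels always refer to. -/
structure LabeledPoset (n : ℕ) where
  order : PartialOrder (Fin n)

/-- `P.le i j` means `i ≤_P j`. -/
def LabeledPoset.le {n : ℕ} (P : LabeledPoset n) (i j : Fin n) : Prop := P.order.le i j

/-- `P.lt i j` means `i <_P j`, that is, `i ≤_P j` and `i ≠ j`. -/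
def LabeledPoset.lt {n : ℕ} (P : LabeledPoset n) (i j : Fin n) : Prop := P.le i j ∧ i ≠ j

/-- A unit interval order: there are real numbers `q i` such that `i ↦ [q i, q i + 1]` is injective
(that is, a bijection onto a set of closed unit intervals) and `i <_P j` holds exactly when the
interval of `i` lies entirely to the left of the interval of `j`. -/
def IsUnitIntervalOrder {n : ℕ} (P : LabeledPoset n) : Prop :=
  ∃ q : Fin n → ℝ, (Function.Injective fun i => Set.Icc (q i) (q i + 1)) ∧
    ∀ i j, P.lt i j ↔ q i + 1 < q j

/-- Isomorphism of posets on `Fin n`. -/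
def Isomorphic {n : ℕ} (P Q : LabeledPoset n) : Prop :=
  ∃ f : Equiv.Perm (Fin n), ∀ i j, P.le i j ↔ Q.le (f i) (f j)

/-- Isomorphism as an equivalence relation on the unit interval orders on `Fin n`. -/
instance isoSetoid (n : ℕ) : Setoid {P : LabeledPoset n // IsUnitIntervalOrder P} where
  r P Q := Isomorphic P.1 Q.1
  iseqv :=
    { refl := fun P => ⟨Equiv.refl _, fun _ _ => Iff.rfl⟩
      symm := fun {P Q} ⟨f, hf⟩ => ⟨f.symm, fun i j => by simp [hf]⟩
      trans := fun {P Q R} ⟨f, hf⟩ ⟨g, hg⟩ =>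
        ⟨f.trans g, fun i j => by rw [hf, hg]; rfl⟩ }

/-- `𝒰ₙ`: the unit interval orders of cardinality `n`, up to isomorphism. -/
def UnitIntervalOrderClass (n : ℕ) := Quotient (isoSetoid n)

/-- The class of a unit interval order in `𝒰ₙ`. -/
def UnitIntervalOrderClass.mk {n : ℕ} (P : LabeledPoset n) (hP : IsUnitIntervalOrder P) :
    UnitIntervalOrderClass n :=
  Quotient.mk (isoSetoid n) ⟨P, hP⟩

/-- The antiadjacency matrix of a labeled poset: `a i j = 0` if `i <_P j`, and `a i j = 1`
otherwise. -/
noncomputable def antiadjacency {n : ℕ} (P : LabeledPoset n) : Matrix (Fin n) (Fin n) ℝ :=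
  open Classical in fun i j => if P.lt i j then 0 else 1

/-- A lattice path with `n` unit steps to the east and `n` unit steps to the south, from the
upper-left to the lower-right corner of an `n × n` square, that stays weakly above the main
diagonal.  It is given by the abscissae of its south steps: the south step through row `i`
(`i = 0, …, n - 1`, counted from the top) has the columns `0, …, c i - 1` to its left. -/
structure DyckPath (n : ℕ) where
  /-- the abscissae of the south steps -/
  c : Fin n → ℕ
  mono : Monotone c
  le_width : ∀ i : Fin n, c i ≤ n
  above_diagonal : ∀ i : Fin n, (i : ℕ) + 1 ≤ c i

/-- A Dyck matrix: a binary matrix whose one entries lie to the left of (below) some Dyck path, and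
whose zero entries lie to the right of (above) it. -/
def IsDyckMatrix {n : ℕ} (A : Matrix (Fin n) (Fin n) ℝ) : Prop :=
  ∃ D : DyckPath n, ∀ i j, A i j = if (j : ℕ) < D.c i then 1 else 0

/-- The altitude of `i`: the size of its order ideal minus the size of its dual order ideal. -/
noncomputable def altitude {n : ℕ} (P : LabeledPoset n) (i : Fin n) : ℤ :=
  ({j | P.le j i}.ncard : ℤ) - ({j | P.le i j}.ncard : ℤ)

/-- A canonically labeled poset: the labeling respects altitude. -/
def IsCanonicallyLabeled {n : ℕ} (P : LabeledPoset n) : Prop :=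
  ∀ i j, altitude P i < altitude P j → i < j

/-- The labeled poset in which the new label `i` stands for the element `σ i` of `P`. -/
def relabel {n : ℕ} (P : LabeledPoset n) (σ : Equiv.Perm (Fin n)) : LabeledPoset n :=
  ⟨@PartialOrder.lift _ _ P.order σ σ.injective⟩

theorem relabel_le {n : ℕ} (P : LabeledPoset n) (σ : Equiv.Perm (Fin n)) (i j : Fin n) :
    (relabel P σ).le i j ↔ P.le (σ i) (σ j) := Iff.rfl

theorem altitude_of_iso {n : ℕ} {P Q : LabeledPoset n} {f : Equiv.Perm (Fin n)}
    (hf : ∀ i j, P.le i j ↔ Q.le (f i) (f j)) (i : Fin n) :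
    altitude P i = altitude Q (f i) := by
  have h1 : {j | Q.le j (f i)} = f '' {j | P.le j i} := by
    ext j
    simp only [Set.mem_ofPred_eq, Set.mem_image, hf]
    exact ⟨fun h => ⟨f.symm j, by simpa using h, by simp⟩, fun ⟨k, hk, e⟩ => e ▸ hk⟩
  have h2 : {j | Q.le (f i) j} = f '' {j | P.le i j} := by
    ext j
    simp only [Set.mem_ofPred_eq, Set.mem_image, hf]
    exact ⟨fun h => ⟨f.symm j, by simpa using h, by simp⟩, fun ⟨k, hk, e⟩ => e ▸ hk⟩
  unfold altitude
  rw [h1, h2, Set.ncard_image_of_injective _ f.injective,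
    Set.ncard_image_of_injective _ f.injective]

theorem lt_of_iso {n : ℕ} {P Q : LabeledPoset n} {f : Equiv.Perm (Fin n)}
    (hf : ∀ i j, P.le i j ↔ Q.le (f i) (f j)) (i j : Fin n) :
    P.lt i j ↔ Q.lt (f i) (f j) := by
  unfold LabeledPoset.lt
  rw [hf, f.injective.ne_iff]

/-- Every poset has a canonical labeling. -/
theorem exists_canonical_labeling {n : ℕ} (P : LabeledPoset n) :
    ∃ σ : Equiv.Perm (Fin n), IsCanonicallyLabeled (relabel P σ) := by
  refine ⟨Tuple.sort (altitude P), fun i j hij => ?_⟩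
  rw [altitude_of_iso (Q := P) (f := Tuple.sort (altitude P)) (relabel_le P _),
    altitude_of_iso (Q := P) (f := Tuple.sort (altitude P)) (relabel_le P _)] at hij
  by_contra h
  exact absurd (Tuple.monotone_sort (altitude P) (not_lt.mp h)) (not_le.mpr hij)

theorem altitude_eq_lt {n : ℕ} (P : LabeledPoset n) (i : Fin n) :
    altitude P i = ({j | P.lt j i}.ncard : ℤ) - ({j | P.lt i j}.ncard : ℤ) := by
  have h1 : {j | P.le j i} = insert i {j | P.lt j i} := by
    ext j
    simp only [Set.mem_ofPred_eq, Set.mem_insert_iff]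
    by_cases h : j = i
    · subst h; exact ⟨fun _ => Or.inl rfl, fun _ => P.order.le_refl j⟩
    · simp [LabeledPoset.lt, h]
  have h2 : {j | P.le i j} = insert i {j | P.lt i j} := by
    ext j
    simp only [Set.mem_ofPred_eq, Set.mem_insert_iff]
    by_cases h : j = i
    · subst h; exact ⟨fun _ => Or.inl rfl, fun _ => P.order.le_refl j⟩
    · simp [LabeledPoset.lt, h, Ne.symm h]
  unfold altitude
  rw [h1, h2, Set.ncard_insert_of_notMem (fun h => h.2 rfl),
    Set.ncard_insert_of_notMem (fun h => h.2 rfl)]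
  push_cast
  ring

/-- Elements of the same altitude in a unit interval order have the same strict upper and lower
sets. -/
theorem lt_iff_of_altitude_eq {n : ℕ} {P : LabeledPoset n} (hP : IsUnitIntervalOrder P)
    {i j : Fin n} (h : altitude P i = altitude P j) (k : Fin n) :
    (P.lt k i ↔ P.lt k j) ∧ (P.lt i k ↔ P.lt j k) := by
  obtain ⟨q, -, hq⟩ := hP
  have key : ∀ i j : Fin n, altitude P i = altitude P j → q i ≤ q j →
      (P.lt k i ↔ P.lt k j) ∧ (P.lt i k ↔ P.lt j k) := by
    intro i j h hij
    have s1 : {k | P.lt k i} ⊆ {k | P.lt k j} := fun k hk => by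
      simp only [Set.mem_ofPred_eq, hq] at hk ⊢; linarith
    have s2 : {k | P.lt j k} ⊆ {k | P.lt i k} := fun k hk => by
      simp only [Set.mem_ofPred_eq, hq] at hk ⊢; linarith
    have c1 := Set.ncard_le_ncard s1
    have c2 := Set.ncard_le_ncard s2
    rw [altitude_eq_lt, altitude_eq_lt] at h
    have e1 := Set.eq_of_subset_of_ncard_le s1 (by omega)
    have e2 := Set.eq_of_subset_of_ncard_le s2 (by omega)
    exact ⟨Set.ext_iff.mp e1 k, (Set.ext_iff.mp e2 k).symm⟩
  rcases le_total (q i) (q j) with hij | hij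
  · exact key i j h hij
  · exact ⟨(key j i h.symm hij).1.symm, (key j i h.symm hij).2.symm⟩

theorem IsCanonicallyLabeled.monotone {n : ℕ} {P : LabeledPoset n} (h : IsCanonicallyLabeled P) :
    Monotone (altitude P) := by
  intro i j hij
  by_contra hlt
  exact absurd (h j i (not_le.mp hlt)) (not_lt.mpr hij)

/-- Isomorphic canonically labeled unit interval orders have the same antiadjacency matrix. -/
theorem antiadjacency_eq_of_iso {n : ℕ} {P Q : LabeledPoset n} (hQ : IsUnitIntervalOrder Q)
    (cP : IsCanonicallyLabeled P) (cQ : IsCanonicallyLabeled Q) (h : Isomorphic P Q) :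
    antiadjacency P = antiadjacency Q := by
  obtain ⟨f, hf⟩ := h
  have e : altitude Q ∘ f = altitude Q ∘ (Equiv.refl (Fin n)) := by
    refine Tuple.unique_monotone ?_ ?_
    · have : altitude Q ∘ f = altitude P := funext fun i => (altitude_of_iso hf i).symm
      rw [this]; exact cP.monotone
    · exact cQ.monotone
  have e' : ∀ i, altitude Q (f i) = altitude Q i := fun i => congrFun e i
  funext i j
  have : P.lt i j ↔ Q.lt i j := by
    rw [lt_of_iso hf, (lt_iff_of_altitude_eq hQ (e' i) (f j)).2,
      (lt_iff_of_altitude_eq hQ (e' j) i).1]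
  unfold antiadjacency
  by_cases h : P.lt i j
  · rw [if_pos h, if_pos (this.mp h)]
  · rw [if_neg h, if_neg (fun h' => h (this.mpr h'))]

theorem relabel_isUnitIntervalOrder {n : ℕ} {P : LabeledPoset n} (hP : IsUnitIntervalOrder P)
    (σ : Equiv.Perm (Fin n)) : IsUnitIntervalOrder (relabel P σ) := by
  obtain ⟨q, hi, hq⟩ := hP
  exact ⟨q ∘ σ, fun i j h => σ.injective (hi h), fun i j => by
    rw [lt_of_iso (relabel_le P σ)]; exact hq (σ i) (σ j)⟩

/-- The map `φ` on `𝒰ₙ`: the antiadjacency matrix with respect to a canonical labeling. -/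
noncomputable def phi {n : ℕ} : UnitIntervalOrderClass n → Matrix (Fin n) (Fin n) ℝ :=
  Quotient.lift (fun P => antiadjacency (relabel P.1 (exists_canonical_labeling P.1).choose)) (by
    rintro P Q ⟨f, hf⟩
    set σ := (exists_canonical_labeling P.1).choose
    set τ := (exists_canonical_labeling Q.1).choose
    refine antiadjacency_eq_of_iso (relabel_isUnitIntervalOrder Q.2 τ)
      (exists_canonical_labeling P.1).choose_spec (exists_canonical_labeling Q.1).choose_spec
      ⟨(σ.trans f).trans τ.symm, fun i j => ?_⟩
    rw [relabel_le, relabel_le, hf]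
    simp only [Equiv.trans_apply, Equiv.apply_symm_apply, Equiv.apply_symm_apply])

/-- `φ` may be computed with any canonical labeling. -/
theorem phi_mk_of_isCanonicallyLabeled {n : ℕ} {P : LabeledPoset n} (hP : IsUnitIntervalOrder P)
    (cP : IsCanonicallyLabeled P) : phi (UnitIntervalOrderClass.mk P hP) = antiadjacency P :=
  antiadjacency_eq_of_iso hP (exists_canonical_labeling P).choose_spec cP
    ⟨(exists_canonical_labeling P).choose, fun _ _ => Iff.rfl⟩

/-- The map `ψ` from `n × n` to `n × 2n` matrices.  The first `n` columns form the identity matrix;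
in the last `n` columns the rows of `A` appear in reverse order with alternating signs: the bottom
row is `a₁`, the one above it `-a₂`, …, and the top row is `(-1)^(n-1) aₙ`. -/
def psi {n : ℕ} (A : Matrix (Fin n) (Fin n) ℝ) : Matrix (Fin n) (Fin (2 * n)) ℝ :=
  fun i j =>
    if h : (j : ℕ) < n then (if (i : ℕ) = (j : ℕ) then 1 else 0)
    else (-1) ^ (i.rev : ℕ) * A i.rev ⟨(j : ℕ) - n, by omega⟩

/-- `Mat^{≥0}_{d,m}`: the full rank `d × m` matrices with nonnegative maximal minors. -/
def nonnegMat (d m : ℕ) : Set (Matrix (Fin d) (Fin m) ℝ) :=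
  {A | A.rank = d ∧ ∀ e : Fin d ↪o Fin m, 0 ≤ (A.submatrix id e).det}

/-- Linear independence of the family of columns indexed by `I`. -/
def ColumnsIndep {d m : ℕ} (A : Matrix (Fin d) (Fin m) ℝ) (I : Set (Fin m)) : Prop :=
  LinearIndepOn ℝ A.col I

theorem columnsIndep_aug {d m : ℕ} (A : Matrix (Fin d) (Fin m) ℝ) {I J : Set (Fin m)}
    (hI : ColumnsIndep A I) (hJ : ColumnsIndep A J) (hIJ : I.ncard < J.ncard) :
    ∃ e ∈ J, e ∉ I ∧ ColumnsIndep A (insert e I) := by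
  classical
  by_contra! H
  have hsub : A.col '' J ⊆ Submodule.span ℝ (A.col '' I) := by
    rintro _ ⟨e, heJ, rfl⟩
    by_cases heI : e ∈ I
    · exact Submodule.subset_span ⟨e, heI, rfl⟩
    · by_contra hne
      exact H e heJ heI (hI.insert hne)
  have hle := Submodule.finrank_mono (Submodule.span_le.mpr hsub)
  have hr : ∀ K : Set (Fin m), ColumnsIndep A K →
      Module.finrank ℝ (Submodule.span ℝ (A.col '' K)) = K.ncard := by
    intro K hK
    have := finrank_span_eq_card (R := ℝ) (b := fun x : K => A.col x) hK
    rw [Set.image_eq_range, this, ← Nat.card_eq_fintype_card, Nat.card_coe_set_eq]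
  rw [hr I hI, hr J hJ] at hle
  omega

/-- `ρ(A)`: the matroid on the column labels of `A` represented by `A`. -/
def rho {d m : ℕ} (A : Matrix (Fin d) (Fin m) ℝ) : Matroid (Fin m) :=
  (IndepMatroid.ofFinite (E := Set.univ) Set.finite_univ (ColumnsIndep A)
    (linearIndepOn_empty ℝ _)
    (fun _ _ hJ hIJ => LinearIndepOn.mono hJ hIJ)
    (fun _ _ hI hJ hIJ => columnsIndep_aug A hI hJ hIJ)
    (fun _ _ => Set.subset_univ _)).matroid

/-- For a matrix of full rank the bases of `ρ(A)` are the sets `B` for which the columns indexed by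
`B` form a basis of `ℝ^d`. -/
theorem rho_isBase_iff {d m : ℕ} {A : Matrix (Fin d) (Fin m) ℝ} (hA : A.rank = d)
    (B : Set (Fin m)) :
    (rho A).IsBase B ↔
      LinearIndepOn ℝ A.col B ∧ Submodule.span ℝ (A.col '' B) = ⊤ := by
  have hind : ∀ I, (rho A).Indep I ↔ LinearIndepOn ℝ A.col I := fun I => Iff.rfl
  have htop : Submodule.span ℝ (Set.range A.col) = ⊤ := by
    apply Submodule.eq_top_of_finrank_eq
    rw [← Matrix.rank_eq_finrank_span_cols, hA]; simp
  rw [Matroid.isBase_iff_maximal_indep]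
  constructor
  · rintro ⟨hB, hmax⟩
    refine ⟨hB, ?_⟩
    rw [eq_top_iff, ← htop, Submodule.span_le]
    rintro _ ⟨e, rfl⟩
    by_contra hne
    have hins : (rho A).Indep (insert e B) := LinearIndepOn.insert hB hne
    have heB : e ∈ B := hmax hins (Set.subset_insert e B) (Set.mem_insert e B)
    exact hne (Submodule.subset_span ⟨e, heB, rfl⟩)
  · rintro ⟨hB, hs⟩
    refine ⟨hB, fun I hI hBI e heI => ?_⟩
    by_contra heB
    have h2 : LinearIndepOn ℝ A.col (insert e B) :=
      LinearIndepOn.mono ((hind I).mp hI) (Set.insert_subset heI hBI)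
    exact ((linearIndepOn_insert heB).mp h2).2 (hs ▸ Submodule.mem_top)

/-- A positroid on `[m]`: a matroid represented by a matrix in some `Mat^{≥0}_{d,m}`. -/
def IsPositroid {m : ℕ} (M : Matroid (Fin m)) : Prop :=
  ∃ d : ℕ, ∃ A ∈ nonnegMat d m, M = rho A

/-- `𝒫ₙ`: the unit interval positroids on `[2n]`, that is, the positroids induced by a unit
interval order (labeled so that its antiadjacency matrix is a Dyck matrix). -/
def unitIntervalPositroids (n : ℕ) : Set (Matroid (Fin (2 * n))) :=
  {M | IsPositroid M ∧ ∃ P : LabeledPoset n, IsUnitIntervalOrder P ∧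
    IsDyckMatrix (antiadjacency P) ∧ M = rho (psi (antiadjacency P))}

end UnitIntervalPositroid

namespace UnitIntervalPositroid

/-! Everything passes through the Dyck matrices: `phi` is a bijection from isomorphism classes onto
them (`phi_injective`, `range_phi`), and `rho ∘ psi` is injective on them (`rho_psi_injOn`) with
image the unit interval positroids.

Reversing the rows turns a Dyck matrix into columns of ones that start at the top and shorten to the
right. With the alternating signs, every maximal minor of `psi A` can be expanded from the bottom
row upwards, and `staircase_det_nonneg` tracks the sign.

The matroid determines `A`: exchanging one unit column for column `n + j` leaves a basis exactly
when a certain entry of `A` is nonzero, and a 0/1 matrix is known from its zero pattern.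

On the poset side, a canonical labeling sorts a unit interval order so that strict upper sets are
nested final segments of labels, which is the Dyck shape. Conversely, `exists_endpoints` places
intervals one at a time to realize a given path. Dyck matrices are then counted by ballot numbers.
-/

/-! ### Total nonnegativity of `psi A`. -/

/-- A matrix whose first `p` columns are standard basis vectors with increasing indices, and whose
other columns are alternating initial segments of decreasing lengths, has determinant of a known
sign. -/
theorem staircase_det_nonneg (m : ℕ) (M : Matrix (Fin m) (Fin m) ℝ) (p : ℕ) (hp : p ≤ m)
    (s k : Fin m → ℕ)
    (hs : ∀ j : Fin m, (j : ℕ) < p → ∀ i : Fin m, M i j = if (i : ℕ) = s j then 1 else 0)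
    (hk : ∀ j : Fin m, p ≤ (j : ℕ) → ∀ i : Fin m, M i j = if (i : ℕ) < k j then (-1) ^ (i : ℕ) else 0)
    (smono : ∀ j j' : Fin m, j < j' → (j' : ℕ) < p → s j < s j')
    (kmono : ∀ j j' : Fin m, j ≤ j' → p ≤ (j : ℕ) → k j' ≤ k j) :
    0 ≤ (-1) ^ ((m + 1) * (m + p)) * M.det := by
  induction m generalizing p with
  | zero =>
    obtain rfl : p = 0 := by omega
    simp
  | succ m ih =>
    -- The induction removes the last row, of index `m`. It can meet a unit column (`s j = m`) or
    -- staircase columns of full length; `s j > m` means that column `j` is zero.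
    by_cases hA : ∃ j : Fin (m + 1), (j : ℕ) < p ∧ m ≤ s j
    · obtain ⟨j, hjp, hj⟩ := hA
      rcases hj.lt_or_eq with hj | hj
      · rw [Matrix.det_eq_zero_of_column_eq_zero j fun i => by
          rw [hs j hjp, if_neg (by omega)]]
        simp
      -- A unit column to the right would have `s > m` and vanish, so otherwise `j` is the last of
      -- the unit columns and the minor has `p - 1 = j` of them.
      by_cases hlast : (j : ℕ) + 1 < p
      · let j' : Fin (m + 1) := ⟨j + 1, by omega⟩
        have h1 : s j < s j' := smono j j' (by simp [j', Fin.lt_def]) hlast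
        rw [Matrix.det_eq_zero_of_column_eq_zero j' fun i => by
          rw [hs j' hlast, if_neg (by omega)]]
        simp
      have hpj : p = j + 1 := by omega
      rw [Matrix.det_succ_column M j, Finset.sum_eq_single (Fin.last m)]
      · have e : M (Fin.last m) j = 1 := by rw [hs j hjp, if_pos (by simpa using hj)]
        have := ih (M.submatrix (Fin.last m).succAbove j.succAbove) j (by omega)
          (fun l => s (j.succAbove l)) (fun l => k (j.succAbove l)) ?_ ?_ ?_ ?_
        · rw [e, mul_one, ← mul_assoc, ← pow_add]
          convert this using 2
          -- The exponents agree mod 2 already as polynomials, so the quadratic monomials can be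
          -- treated as atoms.
          rw [neg_one_pow_eq_pow_mod_two, neg_one_pow_eq_pow_mod_two (n := (m+1) * _)]
          congr 1
          rw [hpj, Fin.val_last]
          ring_nf
          generalize m * (j : ℕ) = x
          generalize m ^ 2 = y
          omega
        · intro l hl i
          have : ((j.succAbove l : Fin _) : ℕ) = l := by
            rw [Fin.succAbove_of_castSucc_lt _ _ (by simpa [Fin.lt_def] using hl)]; simp
          rw [Matrix.submatrix_apply, hs _ (by omega)]; simp
        · intro l hl i
          have : ((j.succAbove l : Fin _) : ℕ) = l + 1 := by
            rw [Fin.succAbove_of_le_castSucc _ _ (by simpa [Fin.le_def] using hl)]; simp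
          rw [Matrix.submatrix_apply, hk _ (by omega)]; simp
        · intro l l' hl hl'
          have : ((j.succAbove l' : Fin _) : ℕ) = l' := by
            rw [Fin.succAbove_of_castSucc_lt _ _ (by simpa [Fin.lt_def] using hl')]; simp
          exact smono _ _ (Fin.strictMono_succAbove j hl) (by omega)
        · intro l l' hl hl'
          have : ((j.succAbove l : Fin _) : ℕ) = l + 1 := by
            rw [Fin.succAbove_of_le_castSucc _ _ (by simpa [Fin.le_def] using hl')]; simp
          exact kmono _ _ ((Fin.strictMono_succAbove j).monotone hl) (by omega)
      · intro i _ hi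
        rw [hs j hjp, if_neg, mul_zero, zero_mul]
        intro h
        exact hi (Fin.ext (by simp; omega))
      · simp
    push Not at hA
    by_cases hB : ∃ j : Fin (m + 1), p ≤ (j : ℕ) ∧ m < k j
    · obtain ⟨j₀, hj₀p, hj₀⟩ := hB
      let j : Fin (m + 1) := ⟨p, by omega⟩
      have hj : m < k j := hj₀.trans_le (kmono j j₀ hj₀p le_rfl)
      -- Two full staircase columns coincide; a single one must be the longest, in position `p`, and
      -- carries the only nonzero entry of the last row.
      by_cases hC : ∃ j' : Fin (m + 1), p < (j' : ℕ) ∧ m < k j'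
      · obtain ⟨j', hj'p, hj'⟩ := hC
        rw [Matrix.det_zero_of_column_eq (i := j) (j := j') (by simp [j, Fin.ext_iff]; omega)
          fun i => by rw [hk j le_rfl, hk j' hj'p.le, if_pos (by omega), if_pos (by omega)]]
        simp
      push Not at hC
      rw [Matrix.det_succ_row M (Fin.last m), Finset.sum_eq_single j]
      · have e : M (Fin.last m) j = (-1) ^ m := by
          rw [hk j le_rfl, if_pos (by simpa using hj)]; simp
        have hlt : ∀ l : Fin m, (l : ℕ) < p → ((j.succAbove l : Fin _) : ℕ) = l := by
          intro l hl
          rw [Fin.succAbove_of_castSucc_lt _ _ (by simpa [Fin.lt_def, j] using hl)]; simp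
        have hge : ∀ l : Fin m, p ≤ (l : ℕ) → ((j.succAbove l : Fin _) : ℕ) = l + 1 := by
          intro l hl
          rw [Fin.succAbove_of_le_castSucc _ _ (by simpa [Fin.le_def, j] using hl)]; simp
        have := ih (M.submatrix (Fin.last m).succAbove j.succAbove) p (by omega)
          (fun l => s (j.succAbove l)) (fun l => k (j.succAbove l)) ?_ ?_ ?_ ?_
        · rw [e, ← mul_assoc, ← mul_assoc, ← pow_add, ← pow_add]
          convert this using 2
          rw [neg_one_pow_eq_pow_mod_two, neg_one_pow_eq_pow_mod_two (n := (m+1) * _)]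
          congr 1
          rw [Fin.val_last]
          simp only [j]
          ring_nf
          generalize m * p = x
          generalize m ^ 2 = y
          omega
        · intro l hl i
          have := hlt l hl
          rw [Matrix.submatrix_apply, hs _ (by omega)]; simp
        · intro l hl i
          have := hge l hl
          rw [Matrix.submatrix_apply, hk _ (by omega)]; simp
        · intro l l' hl hl'
          have := hlt l' hl'
          exact smono _ _ (Fin.strictMono_succAbove j hl) (by omega)
        · intro l l' hl hl'
          have := hge l hl'
          exact kmono _ _ ((Fin.strictMono_succAbove j).monotone hl) (by omega)
      · intro l _ hl
        have : M (Fin.last m) l = 0 := by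
          by_cases h : (l : ℕ) < p
          · have := hA l h
            rw [hs l h, if_neg (by simp; omega)]
          · have hl' : (l : ℕ) ≠ p := fun h => hl (Fin.ext h)
            have := hC l (by omega)
            rw [hk l (by omega), if_neg (by simp; omega)]
        rw [this, mul_zero, zero_mul]
      · simp
    push Not at hB
    rw [Matrix.det_eq_zero_of_row_eq_zero (Fin.last m) fun l => ?_]
    · simp
    · by_cases h : (l : ℕ) < p
      · have := hA l h
        rw [hs l h, if_neg (by simp; omega)]
      · have := hB l (by omega)
        rw [hk l (by omega), if_neg (by simp; omega)]

/-- A lower set of `Fin n` is an initial segment. -/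
theorem exists_initial_segment {n : ℕ} (S : Fin n → Prop) (hS : ∀ i j, i ≤ j → S j → S i) :
    ∃ p ≤ n, ∀ j : Fin n, (j : ℕ) < p ↔ S j := by
  classical
  by_cases h : ∃ p : ℕ, ∃ hp : p < n, ¬ S ⟨p, hp⟩
  · obtain ⟨hp, hn⟩ := Nat.find_spec h
    refine ⟨Nat.find h, hp.le, fun j => ⟨fun hj => ?_, fun hj => ?_⟩⟩
    · by_contra hc
      exact Nat.find_min h hj ⟨j.2, hc⟩
    · by_contra hc
      exact hn (hS _ j (Fin.mk_le_of_le_val (not_lt.mp hc)) hj)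
  · push Not at h
    exact ⟨n, le_rfl, fun j => ⟨fun _ => h j j.2, fun _ => j.2⟩⟩

/-- Since `e` is increasing, the chosen columns are `p` unit columns followed by staircase columns
of lengths `k j`. The sign `(-1) ^ (n - 1 - i)` equals `(-1) ^ (n + 1) * (-1) ^ i`; pulling the
constant out of the last `n - p` columns yields exactly the sign of `staircase_det_nonneg`. -/
theorem psi_minor_nonneg {n : ℕ} {A : Matrix (Fin n) (Fin n) ℝ} (hA : IsDyckMatrix A)
    (e : Fin n ↪o Fin (2 * n)) : 0 ≤ ((psi A).submatrix id e).det := by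
  obtain ⟨D, hD⟩ := hA
  obtain ⟨p, hpn, hp⟩ := exists_initial_segment (fun j => (e j : ℕ) < n) fun i j hij hj =>
    lt_of_le_of_lt (e.monotone hij) hj
  have hcol : ∀ j : Fin n, ∃ t ≤ n, ∀ i : Fin n, (i : ℕ) < t ↔
      (e j : ℕ) < D.c i.rev + n := fun j =>
    exists_initial_segment _ fun i i' hii h => h.trans_le (by
      have := D.mono (Fin.rev_le_rev.mpr hii); omega)
  choose k hkn hk using hcol
  have hM : ∀ i j, (psi A).submatrix id e i j =
      (if (j : ℕ) < p then 1 else (-1) ^ (n + 1)) *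
        (if (j : ℕ) < p then (if (i : ℕ) = (e j : ℕ) then 1 else 0)
        else if (i : ℕ) < k j then (-1) ^ (i : ℕ) else 0) := by
    intro i j
    by_cases hj : (j : ℕ) < p
    · have := (hp j).mp hj
      simp [psi, hj, this]
    · have h := mt (hp j).mpr hj
      have hi := i.2
      have hsign : (-1 : ℝ) ^ (i.rev : ℕ) = (-1) ^ (n + 1) * (-1) ^ (i : ℕ) := by
        rw [← pow_add, neg_one_pow_eq_pow_mod_two,
          neg_one_pow_eq_pow_mod_two (n := n + 1 + _), Fin.val_rev]
        congr 1
        omega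
      have hiff : (e j : ℕ) - n < D.c i.rev ↔ (i : ℕ) < k j := by
        rw [hk]; omega
      simp only [psi, Matrix.submatrix_apply, id, hj, h, if_false, dite_false, hD, hiff, hsign]
      split_ifs <;> ring
  have hdet := Matrix.det_mul_row
    (fun j : Fin n => if (j : ℕ) < p then (1 : ℝ) else (-1) ^ (n + 1))
    (Matrix.of fun i j : Fin n => (if (j : ℕ) < p then (if (i : ℕ) = (e j : ℕ) then (1 : ℝ) else 0)
        else if (i : ℕ) < k j then (-1) ^ (i : ℕ) else 0))
  have hMe : (psi A).submatrix id e = Matrix.of fun i j : Fin n =>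
      (if (j : ℕ) < p then (1 : ℝ) else (-1) ^ (n + 1)) *
        (Matrix.of fun i j : Fin n => (if (j : ℕ) < p then
          (if (i : ℕ) = (e j : ℕ) then (1 : ℝ) else 0)
        else if (i : ℕ) < k j then (-1) ^ (i : ℕ) else 0)) i j := by
    ext i j
    rw [hM]; rfl
  rw [hMe, hdet]
  have hprod : ∏ j : Fin n, (if (j : ℕ) < p then (1 : ℝ) else (-1) ^ (n + 1)) =
      (-1) ^ ((n + 1) * (n + p)) := by
    rw [Fin.prod_univ_eq_prod_range (fun j => if j < p then (1 : ℝ) else (-1) ^ (n + 1)) n,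
      ← Finset.prod_range_mul_prod_Ico _ hpn,
      Finset.prod_congr rfl fun j hj => if_pos (Finset.mem_range.mp hj),
      Finset.prod_congr rfl fun j hj => if_neg (not_lt.mpr (Finset.mem_Ico.mp hj).1)]
    simp only [Finset.prod_const, Nat.card_Ico, one_pow, one_mul, ← pow_mul]
    obtain ⟨d, rfl⟩ := Nat.exists_eq_add_of_le hpn
    -- The exponents `(n + 1) * (n - p)` and `(n + 1) * (n + p)` differ by the even number `2 * ((n
    -- + 1) * p)`.
    rw [show (p + d + 1) * (p + d + p) = (p + d + 1) * (p + d - p) + 2 * ((p + d + 1) * p) by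
      rw [Nat.add_sub_cancel_left]; ring, pow_add, pow_mul (-1 : ℝ) 2]
    simp
  rw [hprod]
  refine staircase_det_nonneg n _ p hpn (fun j => e j) k ?_ ?_ ?_ ?_
  · intro j hj i
    simp [hj]
  · intro j hj i
    simp [not_lt.mpr hj]
  · intro j j' hjj _
    exact e.strictMono hjj
  · intro j j' hjj _
    -- Row `k j` would lie in the segment of column `j'`, hence in that of the earlier column `j`,
    -- giving `k j < k j`.
    by_contra! hlt
    have h1 := (hk j' ⟨k j, hlt.trans_le (hkn j')⟩).mp hlt
    have h2 : (e j : ℕ) ≤ e j' := e.monotone hjj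
    have h3 := (hk j ⟨k j, hlt.trans_le (hkn j')⟩).mpr (by omega)
    simp at h3

theorem psi_rank {n : ℕ} (A : Matrix (Fin n) (Fin n) ℝ) : (psi A).rank = n := by
  apply le_antisymm
  · simpa using (psi A).rank_le_height
  · have h := Matrix.rank_submatrix_le (psi A) id (Fin.castLE (by omega : n ≤ 2 * n))
    have h1 : (psi A).submatrix id (Fin.castLE (by omega : n ≤ 2 * n)) = 1 := by
      ext i j
      simp [psi, Matrix.one_apply, Fin.ext_iff]
    rw [h1, Matrix.rank_one] at h
    simpa using h

theorem psi_mem_nonnegMat {n : ℕ} {A : Matrix (Fin n) (Fin n) ℝ} (hA : IsDyckMatrix A) :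
    psi A ∈ nonnegMat n (2 * n) :=
  ⟨psi_rank A, psi_minor_nonneg hA⟩

/-! ### Recovering a Dyck matrix from its matroid. -/

/-- The entry `A i j` vanishes iff exchanging the unit vector with index `i.rev` for column `n + j`
destroys independence. -/
theorem columnsIndep_psi_exchange_iff {n : ℕ} (A : Matrix (Fin n) (Fin n) ℝ) (i j : Fin n) :
    ColumnsIndep (psi A) (insert ⟨n + j, by omega⟩ {l | (l : ℕ) < n ∧ (l : ℕ) ≠ (i.rev : ℕ)}) ↔
      A i j ≠ 0 := by
  set T : Set (Fin (2 * n)) := {l | (l : ℕ) < n ∧ (l : ℕ) ≠ (i.rev : ℕ)} with hT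
  have hcol : ∀ l : Fin (2 * n), ∀ h : (l : ℕ) < n,
      (psi A).col l = Pi.single (⟨l, h⟩ : Fin n) (1 : ℝ) := by
    intro l h
    ext r
    simp [psi, Matrix.col, h, Pi.single_apply, Fin.ext_iff]
  have hTi : LinearIndepOn ℝ (psi A).col T := by
    have := (Pi.basisFun ℝ (Fin n)).linearIndependent.comp
      (fun l : T => (⟨l.1, l.2.1⟩ : Fin n)) (fun a b h => Subtype.ext (Fin.ext (by simpa using h)))
    have e : (fun l : T => (psi A).col l) =
        Pi.basisFun ℝ (Fin n) ∘ fun l : T => (⟨l.1, l.2.1⟩ : Fin n) := by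
      funext l
      rw [hcol l l.2.1]
      simp
    change LinearIndependent ℝ fun l : T => (psi A).col l
    rw [e]
    exact this
  have hnot : (⟨n + j, by omega⟩ : Fin (2 * n)) ∉ T := fun h => absurd h.1 (by simp)
  have hval : (psi A).col ⟨n + j, by omega⟩ i.rev = (-1) ^ (i : ℕ) * A i j := by
    simp only [Matrix.col, Matrix.transpose_apply, psi]
    rw [dif_neg (by simp)]
    simp only [Fin.rev_rev, Nat.add_sub_cancel_left]
  unfold ColumnsIndep
  -- The columns in `T` span the hyperplane where coordinate `i.rev` vanishes, and that coordinate
  -- of column `n + j` is `± A i j`.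
  rw [linearIndepOn_insert hnot, and_iff_right hTi, not_iff_comm]
  constructor
  · intro h
    have hz : (psi A).col ⟨n + j, by omega⟩ i.rev = 0 := by rw [hval, not_not.mp h, mul_zero]
    rw [← Finset.univ_sum_single ((psi A).col ⟨n + j, by omega⟩)]
    refine Submodule.sum_mem _ fun l _ => ?_
    by_cases hl : l = i.rev
    · rw [hl, hz, Pi.single_zero]
      exact Submodule.zero_mem _
    · have hmem : (⟨l, by omega⟩ : Fin (2 * n)) ∈ T := ⟨l.2, fun h => hl (Fin.ext h)⟩
      have := Submodule.smul_mem _ ((psi A).col ⟨n + j, by omega⟩ l)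
        (Submodule.subset_span (R := ℝ) (Set.mem_image_of_mem (psi A).col hmem))
      rw [hcol ⟨l, by omega⟩ l.2] at this
      simpa [← Pi.single_smul] using this
  · intro h
    have hle : Submodule.span ℝ ((psi A).col '' T) ≤
        LinearMap.ker (LinearMap.proj (R := ℝ) (φ := fun _ : Fin n => ℝ) i.rev) := by
      rw [Submodule.span_le]
      rintro _ ⟨l, hl, rfl⟩
      rw [hcol l hl.1]
      simp only [SetLike.mem_coe, LinearMap.mem_ker, LinearMap.proj_apply]
      exact Pi.single_eq_of_ne (fun h => hl.2 (by rw [h])) _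
    have h0 := hle h
    rw [LinearMap.mem_ker, LinearMap.proj_apply, hval] at h0
    simpa using h0

theorem rho_psi_injOn (n : ℕ) :
    Set.InjOn (fun A : Matrix (Fin n) (Fin n) ℝ => rho (psi A)) {A | IsDyckMatrix A} := by
  rintro A ⟨D, hD⟩ B ⟨E, hE⟩ h
  have hAB : rho (psi A) = rho (psi B) := h
  ext i j
  have key : A i j ≠ 0 ↔ B i j ≠ 0 := by
    rw [← columnsIndep_psi_exchange_iff, ← columnsIndep_psi_exchange_iff]
    change (rho (psi A)).Indep _ ↔ (rho (psi B)).Indep _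
    rw [hAB]
  rw [hD, hE] at key ⊢
  split_ifs at key ⊢ <;> simp_all

/-! ### Canonical labelings and Dyck matrices. -/

theorem isDyckMatrix_iff_lt {n : ℕ} {P : LabeledPoset n} (D : DyckPath n) :
    (∀ i j, antiadjacency P i j = if (j : ℕ) < D.c i then 1 else 0) ↔
      ∀ i j : Fin n, P.lt i j ↔ D.c i ≤ j := by
  refine forall₂_congr fun i j => ?_
  unfold antiadjacency
  by_cases h : P.lt i j <;> by_cases h' : (j : ℕ) < D.c i <;> simp [h, h', ← not_lt]

/-- In a canonically labeled unit interval order, strict lower sets grow and strict upper sets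
shrink with the label. -/
theorem IsCanonicallyLabeled.lt_of_le {n : ℕ} {P : LabeledPoset n} (cP : IsCanonicallyLabeled P)
    (hP : IsUnitIntervalOrder P) {i j : Fin n} (hij : i ≤ j) (k : Fin n) :
    (P.lt k i → P.lt k j) ∧ (P.lt j k → P.lt i k) := by
  rcases (cP.monotone hij).eq_or_lt with h | h
  · have := lt_iff_of_altitude_eq hP h k
    exact ⟨this.1.mp, this.2.mpr⟩
  obtain ⟨q, -, hq⟩ := hP
  -- An interval further left has a smaller lower set and a larger upper set, so `q j < q i` would
  -- reverse the altitudes.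
  have hlt : q i ≤ q j := by
    by_contra! hc
    refine absurd h (not_lt.mpr ?_)
    rw [altitude_eq_lt, altitude_eq_lt]
    have c1 : {k | P.lt k j}.ncard ≤ {k | P.lt k i}.ncard := Set.ncard_le_ncard fun k hk => by
      simp only [Set.mem_ofPred_eq, hq] at hk ⊢; linarith
    have c2 : {k | P.lt i k}.ncard ≤ {k | P.lt j k}.ncard := Set.ncard_le_ncard fun k hk => by
      simp only [Set.mem_ofPred_eq, hq] at hk ⊢; linarith
    omega
  simp only [hq]
  exact ⟨fun _ => by linarith, fun _ => by linarith⟩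

/-- Row `i` of the path ends where the strict upper set of `i` begins. That set is closed under
increasing the label, it shrinks as `i` grows, and it omits `i`; these give the existence,
monotonicity and diagonal condition of `c`. -/
theorem IsCanonicallyLabeled.isDyckMatrix {n : ℕ} {P : LabeledPoset n} (cP : IsCanonicallyLabeled P)
    (hP : IsUnitIntervalOrder P) : IsDyckMatrix (antiadjacency P) := by
  have key : ∀ i : Fin n, ∃ c ≤ n, ∀ j : Fin n, (j : ℕ) < c ↔ ¬ P.lt i j := fun i =>
    exists_initial_segment _ fun j j' hjj h h' => h ((cP.lt_of_le hP hjj i).1 h')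
  choose c hcn hc using key
  refine ⟨⟨c, fun i i' hii => ?_, hcn, fun i => ?_⟩, (isDyckMatrix_iff_lt _).mpr fun i j => ?_⟩
  · by_contra! hlt
    let l : Fin n := ⟨c i', hlt.trans_le (hcn i)⟩
    have h1 := (hc i l).mp hlt
    exact (hc i' l).not.mp (lt_irrefl _) fun h => h1 ((cP.lt_of_le hP hii l).2 h)
  · exact (hc i i).mpr fun h => h.2 rfl
  · rw [← not_lt, hc, not_not]

/-- Monotonicity of the path nests the strict lower and upper sets along the labels, so altitude is
weakly increasing. This lets `phi` be evaluated directly on a poset built from a path. -/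
theorem isCanonicallyLabeled_of_isDyckMatrix {n : ℕ} {P : LabeledPoset n}
    (h : IsDyckMatrix (antiadjacency P)) : IsCanonicallyLabeled P := by
  obtain ⟨D, hD⟩ := h
  rw [isDyckMatrix_iff_lt] at hD
  intro i j hij
  by_contra! hc
  refine absurd hij (not_lt.mpr ?_)
  rw [altitude_eq_lt, altitude_eq_lt]
  have hm := D.mono hc
  have c1 : {k | P.lt k j}.ncard ≤ {k | P.lt k i}.ncard := Set.ncard_le_ncard fun k hk => by
    simp only [Set.mem_ofPred_eq, hD] at hk ⊢; exact hk.trans hc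
  have c2 : {k | P.lt i k}.ncard ≤ {k | P.lt j k}.ncard := Set.ncard_le_ncard fun k hk => by
    simp only [Set.mem_ofPred_eq, hD] at hk ⊢; omega
  omega

theorem phi_isDyckMatrix {n : ℕ} (U : UnitIntervalOrderClass n) : IsDyckMatrix (phi U) := by
  obtain ⟨P, rfl⟩ := Quotient.exists_rep U
  exact (exists_canonical_labeling P.1).choose_spec.isDyckMatrix
    (relabel_isUnitIntervalOrder P.2 _)

theorem le_iff_of_antiadjacency_eq {n : ℕ} {P Q : LabeledPoset n}
    (h : antiadjacency P = antiadjacency Q) (i j : Fin n) : P.le i j ↔ Q.le i j := by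
  have hlt : P.lt i j ↔ Q.lt i j := by
    have := congrFun (congrFun h i) j
    unfold antiadjacency at this
    by_cases h : P.lt i j <;> by_cases h' : Q.lt i j <;> simp_all
  by_cases e : i = j
  · subst e
    exact ⟨fun _ => Q.order.le_refl i, fun _ => P.order.le_refl i⟩
  · simpa [LabeledPoset.lt, e] using hlt

/-- The matrix determines the canonically relabeled order, so composing the two labelings gives an
isomorphism. -/
theorem phi_injective {n : ℕ} : Function.Injective (phi (n := n)) := by
  intro U V h
  obtain ⟨P, rfl⟩ := Quotient.exists_rep U
  obtain ⟨Q, rfl⟩ := Quotient.exists_rep V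
  set σ := (exists_canonical_labeling P.1).choose
  set τ := (exists_canonical_labeling Q.1).choose
  have h' : antiadjacency (relabel P.1 σ) = antiadjacency (relabel Q.1 τ) := h
  refine Quotient.sound ⟨σ.symm.trans τ, fun i j => ?_⟩
  have := le_iff_of_antiadjacency_eq h' (σ.symm i) (σ.symm j)
  simpa [relabel_le] using this

/-! ### Realizing Dyck paths by unit intervals. -/

/-- Left endpoints realizing a Dyck path, with strict inequalities throughout. -/
theorem exists_endpoints {n : ℕ} (D : DyckPath n) (m : ℕ) :
    ∃ q : Fin n → ℝ, ∀ i j : Fin n, (i : ℕ) < m → (j : ℕ) < m →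
      (i < j → q i < q j) ∧ (D.c i ≤ j → q i + 1 < q j) ∧ ((j : ℕ) < D.c i → q j < q i + 1) := by
  classical
  induction m with
  | zero => exact ⟨0, fun i j h => absurd h (Nat.not_lt_zero _)⟩
  | succ m ih =>
    obtain ⟨q, hq⟩ := ih
    by_cases hm : m < n
    swap
    · exact ⟨q, fun i j hi hj => hq i j (by omega) (by omega)⟩
    let L : Finset (Fin n) := Finset.univ.filter fun i => (i : ℕ) < m
    -- The endpoint `x` of label `m` must exceed every earlier `q i`, exceed `q i + 1` when `c i ≤
    -- m`, and stay below `q j + 1` when `m < c j`. These bounds are compatible: `q i < q j + 1` by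
    -- induction, and `c i ≤ m < c j` forces `i < j`, hence `q i + 1 < q j + 1`. Strict inequalities
    -- leave room for `x`.
    obtain ⟨x, hlo, hhi⟩ := Order.exists_between_finsets
      (L.image q ∪ (L.filter fun i => D.c i ≤ m).image fun i => q i + 1)
      ((L.filter fun i => m < D.c i).image fun i => q i + 1) (by
        simp only [Finset.mem_union, Finset.mem_image, Finset.mem_filter, Finset.mem_univ, true_and,
          L]
        rintro _ (⟨i, hi, rfl⟩ | ⟨i, ⟨hi, hi'⟩, rfl⟩) _ ⟨j, ⟨hj, hj'⟩, rfl⟩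
        · exact (hq j i hj hi).2.2 (by omega)
        · have : i < j := by
            by_contra! hc
            have := D.mono hc
            omega
          have := (hq i j hi hj).1 this
          linarith)
    simp only [Finset.mem_union, Finset.mem_image, Finset.mem_filter, Finset.mem_univ, true_and,
          L] at hlo hhi
    have lo1 : ∀ i : Fin n, (i : ℕ) < m → q i < x := fun i hi => hlo _ (Or.inl ⟨i, hi, rfl⟩)
    have lo2 : ∀ i : Fin n, (i : ℕ) < m → D.c i ≤ m → q i + 1 < x := fun i hi h =>
      hlo _ (Or.inr ⟨i, ⟨hi, h⟩, rfl⟩)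
    have hi1 : ∀ i : Fin n, (i : ℕ) < m → m < D.c i → x < q i + 1 := fun i hi h =>
      hhi _ ⟨i, ⟨hi, h⟩, rfl⟩
    refine ⟨Function.update q ⟨m, hm⟩ x, fun i j hi hj => ?_⟩
    have hab := D.above_diagonal i
    rcases (Nat.lt_succ_iff_lt_or_eq.mp hi) with hi | hi <;>
      rcases (Nat.lt_succ_iff_lt_or_eq.mp hj) with hj | hj
    · rw [Function.update_of_ne (Fin.ne_of_val_ne hi.ne),
        Function.update_of_ne (a := j) (Fin.ne_of_val_ne hj.ne)]
      exact hq i j hi hj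
    · obtain rfl : j = ⟨m, hm⟩ := Fin.ext hj
      rw [Function.update_of_ne (Fin.ne_of_val_ne hi.ne), Function.update_self]
      exact ⟨fun _ => lo1 i hi, lo2 i hi, hi1 i hi⟩
    · obtain rfl : i = ⟨m, hm⟩ := Fin.ext hi
      rw [Function.update_of_ne (a := j) (Fin.ne_of_val_ne hj.ne), Function.update_self]
      refine ⟨fun h => absurd (Fin.lt_def.mp h) (by simp; omega), fun h => by simp at hab; omega,
        fun _ => by linarith [lo1 j hj]⟩
    · obtain rfl : i = ⟨m, hm⟩ := Fin.ext hi
      obtain rfl : j = ⟨m, hm⟩ := Fin.ext hj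
      rw [Function.update_self]
      refine ⟨fun h => absurd h (lt_irrefl _), fun h => by simp at hab h; omega,
        fun _ => by linarith⟩

/-- The poset on labels in which `i` is below the labels outside the first `c i` columns. -/
def DyckPath.toPoset {n : ℕ} (D : DyckPath n) : LabeledPoset n where
  order :=
    { le := fun i j => i = j ∨ D.c i ≤ j
      lt := fun i j => (i = j ∨ D.c i ≤ j) ∧ ¬(j = i ∨ D.c j ≤ i)
      lt_iff_le_not_ge := fun _ _ => Iff.rfl
      le_refl := fun _ => Or.inl rfl
      le_trans := by
        rintro i j k (rfl | h) (rfl | h')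
        · exact Or.inl rfl
        · exact Or.inr h'
        · exact Or.inr h
        · have := D.above_diagonal j
          exact Or.inr (by omega)
      le_antisymm := by
        rintro i j (rfl | h) (h' | h')
        · rfl
        · rfl
        · exact h'.symm
        · have := D.above_diagonal i
          have := D.above_diagonal j
          omega }

theorem DyckPath.toPoset_lt {n : ℕ} (D : DyckPath n) (i j : Fin n) :
    D.toPoset.lt i j ↔ D.c i ≤ j := by
  have := D.above_diagonal i
  refine ⟨fun h => h.1.resolve_left h.2, fun h => ⟨Or.inr h, ?_⟩⟩
  rintro rfl
  omega

theorem DyckPath.toPoset_isUnitIntervalOrder {n : ℕ} (D : DyckPath n) :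
    IsUnitIntervalOrder D.toPoset := by
  obtain ⟨q, hq⟩ := exists_endpoints D n
  have hmono : StrictMono q := fun i j h => (hq i j i.2 j.2).1 h
  refine ⟨q, fun i j h => hmono.injective ?_, fun i j => ?_⟩
  · have h' : Set.Icc (q i) (q i + 1) = Set.Icc (q j) (q j + 1) := h
    exact ((Set.Icc_eq_Icc_iff (by linarith)).mp h').1
  · rw [D.toPoset_lt]
    refine ⟨(hq i j i.2 j.2).2.1, fun h => ?_⟩
    by_contra! hc
    linarith [(hq i j i.2 j.2).2.2 hc]

theorem exists_poset_of_isDyckMatrix {n : ℕ} {A : Matrix (Fin n) (Fin n) ℝ} (hA : IsDyckMatrix A) :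
    ∃ P : LabeledPoset n, IsUnitIntervalOrder P ∧ antiadjacency P = A := by
  obtain ⟨D, hD⟩ := hA
  refine ⟨D.toPoset, D.toPoset_isUnitIntervalOrder, ?_⟩
  ext i j
  rw [hD, (isDyckMatrix_iff_lt D).mpr D.toPoset_lt]

/-! ### Counting Dyck paths. -/

/-- Monotone sequences of length `m` above the diagonal and bounded by `k`. -/
def boundedDyckSeqs (m k : ℕ) : Set (Fin m → ℕ) :=
  {c | Monotone c ∧ (∀ i, c i ≤ k) ∧ ∀ i : Fin m, (i : ℕ) + 1 ≤ c i}

theorem boundedDyckSeqs_finite (m k : ℕ) : (boundedDyckSeqs m k).Finite :=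
  (Set.Finite.pi' fun _ : Fin m => Set.finite_Iic k).subset fun _ hc => hc.2.1

/-- Split on whether the last entry attains the bound `k + 1`. The hypothesis `m ≤ k` makes that
value admissible at the diagonal. -/
theorem boundedDyckSeqs_succ {m k : ℕ} (h : m ≤ k) :
    boundedDyckSeqs (m + 1) (k + 1) = boundedDyckSeqs (m + 1) k ∪
      (fun c : Fin m → ℕ => (Fin.snoc c (k + 1) : Fin (m + 1) → ℕ)) '' boundedDyckSeqs m (k + 1) := by
  ext c
  constructor
  · rintro ⟨h1, h2, h3⟩
    rcases (h2 (Fin.last m)).lt_or_eq with hl | hl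
    · exact Or.inl ⟨h1, fun i => (h1 (Fin.le_last i)).trans (by omega), h3⟩
    · refine Or.inr ⟨Fin.init c, ⟨fun i j hij => h1 (Fin.castSucc_le_castSucc_iff.mpr hij),
        fun i => h2 _, fun i => by simpa [Fin.init] using h3 i.castSucc⟩, ?_⟩
      simp only [← hl, Fin.snoc_init_self]
  · rintro (⟨h1, h2, h3⟩ | ⟨c, ⟨h1, h2, h3⟩, rfl⟩)
    · exact ⟨h1, fun i => (h2 i).trans (by omega), h3⟩
    · refine ⟨fun i j hij => ?_, fun i => ?_, fun i => ?_⟩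
      · induction i using Fin.lastCases with
        | last =>
          obtain rfl := Fin.last_le_iff.mp hij
          exact le_rfl
        | cast i =>
          induction j using Fin.lastCases with
          | last => simpa using h2 i
          | cast j => simpa using h1 (Fin.castSucc_le_castSucc_iff.mp hij)
      · induction i using Fin.lastCases with
        | last => simp
        | cast i => simpa using h2 i
      · induction i using Fin.lastCases with
        | last => simpa using h
        | cast i => simpa using h3 i

theorem ncard_boundedDyckSeqs_succ {m k : ℕ} (h : m ≤ k) :
    (boundedDyckSeqs (m + 1) (k + 1)).ncard =
      (boundedDyckSeqs (m + 1) k).ncard + (boundedDyckSeqs m (k + 1)).ncard := by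
  rw [boundedDyckSeqs_succ h, Set.ncard_union_eq ?_ (boundedDyckSeqs_finite _ _)
    ((boundedDyckSeqs_finite _ _).image _), Set.ncard_image_of_injective]
  · intro c c' hc
    simpa using congrArg Fin.init hc
  · rw [Set.disjoint_left]
    rintro _ hc ⟨c, -, rfl⟩
    have := hc.2.1 (Fin.last m)
    simp at this

theorem ncard_boundedDyckSeqs_zero (k : ℕ) : (boundedDyckSeqs 0 k).ncard = 1 := by
  rw [Set.ncard_eq_one]
  refine ⟨Fin.elim0, Set.eq_singleton_iff_unique_mem.mpr
    ⟨⟨fun i => i.elim0, fun i => i.elim0, fun i => i.elim0⟩, fun c _ => Subsingleton.elim _ _⟩⟩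

/-- The ballot number, written without subtraction. Both sides satisfy Pascal's rule in `m + k`; the
boundary `m = k` is the empty case, where the two binomials agree by symmetry. -/
theorem ncard_boundedDyckSeqs_add (s : ℕ) : ∀ m k : ℕ, m + k = s → m ≤ k →
    (boundedDyckSeqs (m + 1) k).ncard + (m + k + 1).choose m = (m + k + 1).choose (m + 1) := by
  induction s with
  | zero =>
    intro m k h _
    obtain ⟨rfl, rfl⟩ : m = 0 ∧ k = 0 := by omega
    have : boundedDyckSeqs 1 0 = ∅ := Set.eq_empty_iff_forall_notMem.mpr fun c hc => by
      have := hc.2.1 0; have := hc.2.2 0; omega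
    simp [this]
  | succ s ih =>
    intro m k h hmk
    obtain ⟨k, rfl⟩ : ∃ l, k = l + 1 := ⟨k - 1, by omega⟩
    rcases hmk.lt_or_eq with hlt | rfl
    · rw [ncard_boundedDyckSeqs_succ (by omega)]
      have h1 := ih m k (by omega) (by omega)
      rcases m with _ | m
      · rw [ncard_boundedDyckSeqs_zero]
        simp at h1 ⊢
        omega
      · have h2 := ih m (k + 1) (by omega) (by omega)
        have e1 : m + 1 + (k + 1) + 1 = (m + 1 + k + 1) + 1 := by ring
        have e2 : m + (k + 1) + 1 = m + 1 + k + 1 := by ring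
        rw [e2] at h2
        rw [e1, Nat.choose_succ_succ' _ (m + 1), Nat.choose_succ_succ' _ m]
        omega
    · have : boundedDyckSeqs (k + 1 + 1) (k + 1) = ∅ :=
        Set.eq_empty_iff_forall_notMem.mpr fun c hc => by
          have h1 := hc.2.1 (Fin.last _); have h2 := hc.2.2 (Fin.last _)
          simp at h2; omega
      rw [this, Set.ncard_empty, zero_add]
      exact Nat.choose_symm_of_eq_add (by ring)

theorem ncard_boundedDyckSeqs_self (n : ℕ) : (boundedDyckSeqs n n).ncard = catalan n := by
  rcases n with _ | n
  · rw [ncard_boundedDyckSeqs_zero, catalan_zero]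
  have h := ncard_boundedDyckSeqs_add _ n (n + 1) rfl (by omega)
  have h1 := succ_mul_catalan_eq_centralBinom (n + 1)
  have h2 := Nat.choose_succ_right_eq (n + (n + 1) + 1) n
  rw [Nat.centralBinom_eq_two_mul_choose, show 2 * (n + 1) = n + (n + 1) + 1 by ring] at h1
  rw [show n + (n + 1) + 1 - n = n + 2 by omega] at h2
  rw [← h1] at h h2
  generalize (n + (n + 1) + 1).choose n = x at *
  -- The central coefficient is `(n + 2) * catalan (n + 1)` and its neighbour `x` is `(n + 1) *
  -- catalan (n + 1)`; their difference is the count.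
  have h3 : x = (n + 1) * catalan (n + 1) := by
    apply Nat.eq_of_mul_eq_mul_right (show 0 < n + 2 by omega)
    rw [← h2]; ring
  rw [h3] at h
  linarith

theorem ncard_isDyckMatrix (n : ℕ) :
    {A : Matrix (Fin n) (Fin n) ℝ | IsDyckMatrix A}.ncard = catalan n := by
  rw [← ncard_boundedDyckSeqs_self]
  have : {A : Matrix (Fin n) (Fin n) ℝ | IsDyckMatrix A} =
      (fun c : Fin n → ℕ => (Matrix.of fun i j : Fin n => if (j : ℕ) < c i then (1 : ℝ) else 0)) ''
        boundedDyckSeqs n n := by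
    ext A
    constructor
    · rintro ⟨D, hD⟩
      exact ⟨D.c, ⟨D.mono, D.le_width, D.above_diagonal⟩, by ext i j; rw [hD]; rfl⟩
    · rintro ⟨c, ⟨h1, h2, h3⟩, rfl⟩
      exact ⟨⟨c, h1, h2, h3⟩, fun _ _ => rfl⟩
  rw [this]
  refine Set.InjOn.ncard_image fun c hc c' hc' h => ?_
  have key : ∀ i j : Fin n, (j : ℕ) < c i ↔ (j : ℕ) < c' i := by
    intro i j
    have hij : (if (j : ℕ) < c i then (1 : ℝ) else 0) = if (j : ℕ) < c' i then 1 else 0 :=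
      congrFun (congrFun h i) j
    split_ifs at hij with h1 h2 h2
    · exact iff_of_true h1 h2
    · exact absurd hij one_ne_zero
    · exact absurd hij zero_ne_one
    · exact iff_of_false h1 h2
  ext i
  have b := hc.2.1 i
  have b' := hc'.2.1 i
  -- If the lengths differ, the smaller one is below `n`, so it is a column index at which the two
  -- rows disagree.
  rcases lt_trichotomy (c i) (c' i) with hl | hl | hl
  · exact absurd ((key i ⟨c i, by omega⟩).mpr hl) (lt_irrefl _)
  · exact hl
  · exact absurd ((key i ⟨c' i, by omega⟩).mp hl) (lt_irrefl _)

/-! ### Assembling the bijection. -/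

theorem unitIntervalPositroids_eq_image (n : ℕ) :
    unitIntervalPositroids n =
      (fun A : Matrix (Fin n) (Fin n) ℝ => rho (psi A)) '' {A | IsDyckMatrix A} := by
  ext M
  constructor
  · rintro ⟨-, P, -, hD, rfl⟩
    exact ⟨_, hD, rfl⟩
  · rintro ⟨A, hA, rfl⟩
    obtain ⟨P, hP, rfl⟩ := exists_poset_of_isDyckMatrix hA
    exact ⟨⟨n, _, psi_mem_nonnegMat hA, rfl⟩, P, hP, hA, rfl⟩

theorem range_phi (n : ℕ) : Set.range (phi (n := n)) = {A | IsDyckMatrix A} := by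
  ext A
  constructor
  · rintro ⟨U, rfl⟩
    exact phi_isDyckMatrix U
  · intro hA
    obtain ⟨P, hP, rfl⟩ := exists_poset_of_isDyckMatrix hA
    exact ⟨UnitIntervalOrderClass.mk P hP,
      phi_mk_of_isCanonicallyLabeled hP (isCanonicallyLabeled_of_isDyckMatrix hA)⟩

end UnitIntervalPositroid

theorem mainTheorem3 (n : ℕ) :
    (∀ U : UnitIntervalPositroid.UnitIntervalOrderClass n,
      UnitIntervalPositroid.IsDyckMatrix (UnitIntervalPositroid.phi U) ∧
      UnitIntervalPositroid.psi (UnitIntervalPositroid.phi U) ∈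
        UnitIntervalPositroid.nonnegMat n (2 * n)) ∧
    Set.BijOn
      (UnitIntervalPositroid.rho ∘ UnitIntervalPositroid.psi ∘ UnitIntervalPositroid.phi)
      (Set.univ : Set (UnitIntervalPositroid.UnitIntervalOrderClass n))
      (UnitIntervalPositroid.unitIntervalPositroids n) ∧
    (UnitIntervalPositroid.unitIntervalPositroids n).ncard = catalan n := by
  open UnitIntervalPositroid in
  refine ⟨fun U => ⟨phi_isDyckMatrix U, psi_mem_nonnegMat (phi_isDyckMatrix U)⟩,
    ⟨fun U _ => ?_, fun U _ V _ h => ?_, fun M hM => ?_⟩, ?_⟩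
  · rw [unitIntervalPositroids_eq_image]
    exact ⟨_, phi_isDyckMatrix U, rfl⟩
  · exact phi_injective (rho_psi_injOn n (phi_isDyckMatrix U) (phi_isDyckMatrix V) h)
  · rw [unitIntervalPositroids_eq_image, ← range_phi] at hM
    obtain ⟨_, ⟨U, rfl⟩, rfl⟩ := hM
    exact ⟨U, trivial, rfl⟩
  · rw [unitIntervalPositroids_eq_image, (rho_psi_injOn n).ncard_image, ncard_isDyckMatrix]
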